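/- Let $\mathcal F$ be a convex compact subset of an $L^2$ space, let $\Theta\subseteq\mathbb R^p$, and let $\mathcal F_\theta=\{f_\theta:\theta\in\Theta\}\subseteq\mathcal F$. Let $\ell_0,\ell_1,\dots,\ell_m:\mathcal F\to\mathbb R$ and write $\ell=(\ell_1,\dots,\ell_m)$. For $\mathcal S\in\{\mathcal F,\mathcal F_\theta\}$ consider the problem of minimizing $\ell_0(\phi)$ over $\phi\in\mathcal S$ subject to $\ell_i(\phi)\le 0$, $i=1,\dots,m$; it is called the unparametrized problem for $\mathcal S=\mathcal F$ and the parametrized problem for $\mathcal S=\mathcal F_\theta$. Let $P_p^\star$ be the optimal value of the parametrized problem. Let $L(\phi,\lambda)=\ell_0(\phi)+\lambda^T\ell(\phi)$, let $g_u(\lambda)=\inf_{\phi\in\mathcal F}L(\phi,\lambda)$ and $g_p(\lambda)=\inf_{\phi\in\mathcal F_\theta}L(\phi,\lambda)$, and let $\mathcal F^\star(\lambda)$ and $\mathcal F^\star_\theta(\lambda)$ be the sets of minimizers of $L(\cdot,\lambda)$ over $\mathcal F$ and over $\mathcal F_\theta$. Let $\Lambda_p^\star$ be the set of maximizers of $g_p$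 over $\lambda\succeq 0$. Derivatives on $\mathcal F$ are Fréchet derivatives along $\mathcal F$ (that is, with increments $h$ such that $\phi+h\in\mathcal F$), regarded as bounded linear functionals on the linear span $V$ of $\{\phi-\psi:\phi,\psi\in\mathcal F\}$, with the dual norm $\|B\|=\sup\{|B(h)|/\|h\|_{L^2}: 0\ne h\in V\}$. Assume, with constants $M,\beta\ge 0$, $\mu_0,\sigma>0$ and $\nu\in\mathbb R$: 1. $\ell_0,\dots,\ell_m$ are convex and $M$-Lipschitz on $\mathcal F$, and $\ell_0$ is $\mu_0$-strongly convex on $\mathcal F$. 2. There is $\phi\in\mathcal F$ with $\ell_i(\phi)<0$ for all $i$ such that, for all $\lambda\in\Lambda_p^\star$, all $\psi\in\mathcal F^\star(\lambda)\cup\mathcal F_\theta^\star(\lambda)$ and all $i=1,\dots,m$, $\ell_i(\phi)<\ell_i(\psi)$. 3. For every $\phi\in\mathcal F$ there is $\theta\in\Theta$ with $\|\phi-f_\theta\|_{L^2}\le\nu$. 4. $\ell_0,\dots,\ell_m$ are $\beta$-smooth on $\mathcal F$: they are differentiable on $\mathcal F$ with $\beta$-Lipschitz derivative. 5. $\phi^\star$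 is a solution of the unparametrized problem and $\|\lambda^T D\ell(\phi^\star)\|\ge\sigma$ for all $\lambda\in\mathbb R^m$ with $\|\lambda\|_2=1$. Let $\lambda_u^\star$ be a maximizer of $g_u$ over $\lambda\succeq0$ and let $\lambda_p^\star\in\Lambda_p^\star$. Put $\kappa_1=M/\sigma$, $\kappa_0=\beta/\mu_0$, $\Delta=\max\{\|\lambda_u^\star\|_1,\|\lambda_p^\star\|_1\}$ and $$\Gamma_2=M\,[1+\kappa_1\kappa_0(1+\Delta)]\,\sqrt{2m\,\frac{M\nu}{\mu_0}\,(1+\|\lambda_p^\star\|_1)}.$$ Then every Lagrangian minimizer $f_\theta(\lambda_p^\star)\in\mathcal F_\theta^\star(\lambda_p^\star)$ satisfies $$\|\ell(f_\theta(\lambda_p^\star))-\ell(\phi^\star)\|_\infty\le\Gamma_2 .$$ Moreover, if $\tilde\lambda^\star$ maximizes $g_p(\lambda)+M\nu\|\lambda\|_1$ over $\lambda\succeq0$ and $\Gamma_1=M\nu(1+\|\tilde\lambda^\star\|_1)$, then the parametrized problem is feasible and $$|P_p^\star-\ell_0(f_\theta(\lambda_p^\star))|\le(1+\|\lambda_p^\star\|_1)M\nu+\Gamma_1+\|\lambda_p^\star\|_1\Gamma_2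 .$$ -/

import Mathlib

open scoped NNReal
open MeasureTheory

namespace ConstrainedLearning

noncomputable section

/-- The `ℓ¹` norm of a vector of `ℝᵐ`. -/
def l1Norm {m : ℕ} (v : Fin m → ℝ) : ℝ := ∑ i, |v i|

section General

variable {H : Type*} [NormedAddCommGroup H] [NormedSpace ℝ H] {m : ℕ}

/-- The Lagrangian `L(φ, v) = ℓ₀(φ) + vᵀ ℓ(φ)`. The functionals are written as functions on the
whole space `H`; only their values on the function class `F` are ever used below. -/
def lagrangian (l0 : H → ℝ) (l : Fin m → H → ℝ) (φ : H) (v : Fin m → ℝ) : ℝ :=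
  l0 φ + ∑ i, v i * l i φ

/-- The minimizers over the class `S` of the Lagrangian with multiplier `v`. -/
def lagrangianMinimizers (l0 : H → ℝ) (l : Fin m → H → ℝ) (S : Set H) (v : Fin m → ℝ) : Set H :=
  {φ | φ ∈ S ∧ ∀ ψ ∈ S, lagrangian l0 l φ v ≤ lagrangian l0 l ψ v}

/-- The dual function `g_S(v) = inf_{φ ∈ S} L(φ, v)` of the problem posed over the class `S`.
With `S = F` it is the unparametrized dual function, with `S = {f_θ : θ ∈ Θ}` the parametrized
one. -/
def dualFunction (l0 : H → ℝ) (l : Fin m → H → ℝ) (S : Set H) (v : Fin m → ℝ) : ℝ :=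
  ⨅ φ : S, lagrangian l0 l φ v

/-- The optimal dual variables of the problem over `S`: the maximizers of `g_S` on `v ⪰ 0`. -/
def dualOptimal (l0 : H → ℝ) (l : Fin m → H → ℝ) (S : Set H) : Set (Fin m → ℝ) :=
  {v | 0 ≤ v ∧ ∀ w, 0 ≤ w → dualFunction l0 l S w ≤ dualFunction l0 l S v}

/-- The maximizers on `v ⪰ 0` of the perturbed dual function `g_S(v) + c ‖v‖₁`. -/
def perturbedDualOptimal (l0 : H → ℝ) (l : Fin m → H → ℝ) (S : Set H) (c : ℝ) :
    Set (Fin m → ℝ) :=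
  {v | 0 ≤ v ∧ ∀ w, 0 ≤ w →
    dualFunction l0 l S w + c * l1Norm w ≤ dualFunction l0 l S v + c * l1Norm v}

/-- The elements of the class `S` that satisfy the constraints `ℓ_i(φ) ≤ 0`. -/
def feasibleSet (l : Fin m → H → ℝ) (S : Set H) : Set H :=
  {φ | φ ∈ S ∧ ∀ i, l i φ ≤ 0}

/-- The solutions of the constrained problem over `S`. -/
def solutions (l0 : H → ℝ) (l : Fin m → H → ℝ) (S : Set H) : Set H :=
  {φ | φ ∈ feasibleSet l S ∧ ∀ ψ ∈ feasibleSet l S, l0 φ ≤ l0 ψ}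

/-- The optimal value of the constrained problem over `S`. -/
def primalValue (l0 : H → ℝ) (l : Fin m → H → ℝ) (S : Set H) : ℝ :=
  sInf (l0 '' feasibleSet l S)

/-- A functional on `H`, regarded as a bounded linear functional on the directions of `F`, that is,
on the linear span of the differences `φ - ψ` with `φ, ψ ∈ F`. A derivative along `F` is determined
only there. The operator norm of `alongF F B` is the supremum of `|B h| / ‖h‖` over these nonzero
directions `h`; if the differences span a dense subspace of `H`, it is the usual norm of `B`. -/
def alongF (F : Set H) (B : H →L[ℝ] ℝ) : vectorSpan ℝ F →L[ℝ] ℝ :=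
  B.comp (vectorSpan ℝ F).subtypeL

/-- `q` is `β`-smooth on `F`: it is Fréchet differentiable along `F` at each point of `F`, and the
derivative is `β`-Lipschitz in the dual norm. -/
def SmoothAlong (F : Set H) (β : ℝ≥0) (q : H → ℝ) : Prop :=
  ∃ D : H → (H →L[ℝ] ℝ), (∀ φ ∈ F, HasFDerivWithinAt q (D φ) F φ) ∧
    LipschitzOnWith β (fun φ => alongF F (D φ)) F

/-- The Jacobian of `ℓ` at `φ` has full row rank with constant `σ`:
`‖vᵀ Dℓ(φ)‖ ≥ σ` for all `v` with `‖v‖₂ = 1`. -/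
def FullRowRank (F : Set H) (σ : ℝ) (l : Fin m → H → ℝ) (φ : H) : Prop :=
  ∃ J : Fin m → (H →L[ℝ] ℝ), (∀ i, HasFDerivWithinAt (l i) (J i) F φ) ∧
    ∀ v : Fin m → ℝ, ∑ i, v i ^ 2 = 1 → σ ≤ ‖alongF F (∑ i, v i • J i)‖

/-- The strengthened Slater condition: one `φ ∈ F` is strictly feasible, and its constraint values
are strictly below those of all (unparametrized and parametrized) Lagrangian minimizers for all
optimal parametrized dual variables. -/
def StrongSlater (l0 : H → ℝ) (l : Fin m → H → ℝ) (F Fθ : Set H) : Prop :=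
  ∃ φ ∈ F, (∀ i, l i φ < 0) ∧ ∀ v ∈ dualOptimal l0 l Fθ,
    (∀ ψ ∈ lagrangianMinimizers l0 l F v, ∀ i, l i φ < l i ψ) ∧
    (∀ ψ ∈ lagrangianMinimizers l0 l Fθ v, ∀ i, l i φ < l i ψ)

end General

/-- `Γ₁ = M ν (1 + ‖w‖₁)`, to be used with `w` a maximizer of `g_p(v) + M ν ‖v‖₁`. -/
def Gamma1 {m : ℕ} (M ν : ℝ) (w : Fin m → ℝ) : ℝ := M * ν * (1 + l1Norm w)

/-- `Γ₂ = M [1 + κ₁ κ₀ (1 + Δ)] √(2 m (M ν / μ₀) (1 + ‖vp‖₁))`, where `κ₁ = M / σ`, `κ₀ = β / μ₀`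
and `Δ = max {‖vu‖₁, ‖vp‖₁}`. -/
def Gamma2 {m : ℕ} (M ν μ₀ β σ : ℝ) (vu vp : Fin m → ℝ) : ℝ :=
  M * (1 + (M / σ) * (β / μ₀) * (1 + max (l1Norm vu) (l1Norm vp))) *
    √(2 * m * (M * ν / μ₀) * (1 + l1Norm vp))

end

end ConstrainedLearning

/-! Fix `v = lamP` and let `a` minimize the Lagrangian at `v` over `F`; put `ε = M ν (1 + ‖v‖₁)`. By
density `fP` is `ε`-optimal over `F`. So is `φs`: its Lagrangian is at most `l0 φs`, and strong
duality on `F`, with `g_p ≥ g_u`, gives `l0 φs ≤ g_p(v)`, the Lagrangian value of `fP`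
(`le_dualFunction_of_mem_solutions`). Strong convexity places both within `√(2ε/μ₀)` of `a`, so the
constraint values differ by at most `2M√(2ε/μ₀)`. Rank and smoothness serve to compare this with
`Gamma2`: they force `σ ≤ M` and `μ₀ ≤ β` (`FullRowRank.le_and_le`).

For near-optimality, strong duality with constraints tightened by `M ν` yields a point of `F` that
stays feasible when moved into the subclass; hence `g_p(v) ≤ P_p ≤ g_p(v) + Γ₁`. It remains to bound
`vᵀℓ(fP)`, which is close to `vᵀℓ(φs) ∈ [-ε, 0]`. -/

namespace ConstrainedLearning

open Filter Topology
open scoped Pointwise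

/-! ### Strong duality on a compact convex set by separation. -/

section Duality

/-- A system of finitely many convex inequalities that is infeasible on a compact convex set
has a uniformly positive nonnegative combination. -/
theorem exists_weights_of_infeasible {H : Type*} [NormedAddCommGroup H] [NormedSpace ℝ H]
    {ι : Type*} [Fintype ι] {F : Set H} (hF : Convex ℝ F)
    (hcomp : IsCompact F) (hne : F.Nonempty) {q : ι → H → ℝ} (hq : ∀ i, ConvexOn ℝ F (q i))
    (hcont : ∀ i, ContinuousOn (q i) F) (hinf : ¬ ∃ φ ∈ F, ∀ i, q i φ ≤ 0) :
    ∃ w : ι → ℝ, 0 ≤ w ∧ ∃ δ > 0, ∀ φ ∈ F, δ ≤ ∑ i, w i * q i φ := by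
  classical
  obtain ⟨φ₀, hφ₀⟩ := hne
  set A : Set (ι → ℝ) := {u | ∃ φ ∈ F, ∀ i, q i φ ≤ u i} with hA
  have hconv : Convex ℝ A := by
    rintro u ⟨x, hx, hxu⟩ v ⟨y, hy, hyv⟩ a b ha hb hab
    refine ⟨a • x + b • y, hF hx hy ha hb hab, fun i => ((hq i).2 hx hy ha hb hab).trans ?_⟩
    simp only [smul_eq_mul, Pi.add_apply, Pi.smul_apply]
    gcongr
    exacts [hxu i, hyv i]
  have hclosed : IsClosed A := by
    have hKc : IsCompact ((fun φ i => q i φ) '' F) :=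
      hcomp.image_of_continuousOn (continuousOn_pi.2 hcont)
    have hAeq : A = Set.Ici (0 : ι → ℝ) + (fun φ i => q i φ) '' F := by
      ext u
      constructor
      · rintro ⟨φ, hφ, hu⟩
        exact ⟨fun i => u i - q i φ, fun i => sub_nonneg.2 (hu i), _, ⟨φ, hφ, rfl⟩,
          by ext i; simp⟩
      · rintro ⟨v, hv, _, ⟨φ, hφ, rfl⟩, rfl⟩
        refine ⟨φ, hφ, fun i => ?_⟩
        have := hv i
        simpa using this
    rw [hAeq]
    exact isClosed_Ici.add_right_of_isCompact hKc
  obtain ⟨g, r, hg0, hg⟩ := geometric_hahn_banach_point_closed hconv hclosed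
    (x := (0 : ι → ℝ)) (fun ⟨φ, hφ, h⟩ => hinf ⟨φ, hφ, h⟩)
  have hr : 0 < r := by simpa using hg0
  refine ⟨fun i => g (Pi.single i 1), fun i => ?_, r, hr, fun φ hφ => ?_⟩
  · by_contra hneg
    have hneg' : g (Pi.single i 1) < 0 := by simpa using hneg
    set u : ι → ℝ := fun j => q j φ₀ with hu
    -- `A` is upward closed, so `u` may move along the `i`-th axis; this `t` brings `g` down to `g u
    -- - |g u| ≤ 0 < r`.
    set t : ℝ := |g u| / (-g (Pi.single i 1)) with ht
    have ht0 : 0 ≤ t := div_nonneg (abs_nonneg _) (by linarith)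
    have hmem : u + t • Pi.single i (1 : ℝ) ∈ A := by
      refine ⟨φ₀, hφ₀, fun j => ?_⟩
      have : 0 ≤ t * (Pi.single i (1 : ℝ) : ι → ℝ) j := by
        refine mul_nonneg ht0 ?_
        by_cases hij : j = i
        · subst hij; simp
        · simp [hij]
      simpa [hu] using this
    have h1 := hg _ hmem
    rw [map_add, map_smul, smul_eq_mul] at h1
    have h2 : t * g (Pi.single i 1) = -|g u| := by
      rw [ht, div_mul_eq_mul_div, mul_div_assoc, div_neg, div_self hneg'.ne, mul_neg_one]
    linarith [le_abs_self (g u)]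
  · have h1 := (hg (fun j => q j φ) ⟨φ, hφ, fun _ => le_rfl⟩).le
    have h2 : g (fun j => q j φ) = ∑ i, g (Pi.single i 1) * q i φ := by
      conv_lhs => rw [← Finset.univ_sum_single (fun j => q j φ)]
      rw [map_sum]
      refine Finset.sum_congr rfl fun i _ => ?_
      rw [mul_comm, ← smul_eq_mul, ← map_smul, ← Pi.single_smul, smul_eq_mul, mul_one]
    rwa [h2] at h1

/-- Strong duality for convex programs over a compact set: a uniform bound on the dual function
is attained by the objective at a feasible point. -/
theorem exists_feasible_of_dual_le {H : Type*} [NormedAddCommGroup H] [NormedSpace ℝ H] {m : ℕ}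
    {F : Set H} (hcomp : IsCompact F) (hne : F.Nonempty) {l0 : H → ℝ} {l : Fin m → H → ℝ}
    (h0 : ConvexOn ℝ F l0) (hl : ∀ i, ConvexOn ℝ F (l i)) (hc0 : ContinuousOn l0 F)
    (hcl : ∀ i, ContinuousOn (l i) F) (c D : ℝ)
    (hD : ∀ w : Fin m → ℝ, 0 ≤ w → ∃ φ ∈ F, lagrangian l0 l φ w + c * l1Norm w ≤ D) :
    ∃ φ ∈ F, (∀ i, l i φ + c ≤ 0) ∧ l0 φ ≤ D := by
  by_contra hcon
  set q : Option (Fin m) → H → ℝ := fun o φ => o.elim (l0 φ + -D) fun i => l i φ + c with hq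
  obtain ⟨w, hw, δ, hδ, hwδ⟩ := exists_weights_of_infeasible h0.1 hcomp hne (q := q)
    (by
      rintro (_ | i)
      · exact h0.add_const (-D)
      · exact (hl i).add_const c)
    (by
      rintro (_ | i)
      · exact hc0.add continuousOn_const
      · exact (hcl i).add continuousOn_const)
    (by
      rintro ⟨φ, hφ, h⟩
      refine hcon ⟨φ, hφ, fun i => h (some i), ?_⟩
      have := h none
      simp only [hq, Option.elim] at this
      linarith)
  obtain ⟨B, hB⟩ := hcomp.exists_bound_of_continuousOn (hc0.sub (continuousOn_const (c := D)))
  -- A small positive weight may be added to the objective.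
  set η : ℝ := δ / (2 * (|B| + 1)) with hη
  have hη0 : 0 < η := by positivity
  have hs0 : 0 < w none + η := add_pos_of_nonneg_of_pos (hw none) hη0
  have hv : (0 : Fin m → ℝ) ≤ fun i => w (some i) / (w none + η) :=
    fun i => div_nonneg (hw (some i)) hs0.le
  obtain ⟨φ, hφ, hle⟩ := hD _ hv
  have hpos := hwδ φ hφ
  rw [Fintype.sum_option] at hpos
  simp only [hq, Option.elim] at hpos
  have hl1 : l1Norm (fun i => w (some i) / (w none + η)) =
      ∑ i, w (some i) / (w none + η) :=
    Finset.sum_congr rfl fun i _ => abs_of_nonneg (hv i)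
  have hsum : (w none + η) * (lagrangian l0 l φ (fun i => w (some i) / (w none + η)) +
      c * l1Norm (fun i => w (some i) / (w none + η))) =
      (w none + η) * l0 φ + ∑ i, w (some i) * (l i φ + c) := by
    rw [hl1, lagrangian, add_assoc, Finset.mul_sum, ← Finset.sum_add_distrib, mul_add,
      Finset.mul_sum]
    congr 1
    refine Finset.sum_congr rfl fun i _ => ?_
    field_simp
  have hmul := mul_le_mul_of_nonneg_left hle hs0.le
  rw [hsum] at hmul
  have hb := hB φ hφ
  rw [Real.norm_eq_abs, Pi.sub_apply] at hb
  -- The extra weight costs at most half of the margin `δ`; this handles `w none = 0`, where the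
  -- weights could not be normalized into a multiplier.
  have h3 : η * |l0 φ - D| ≤ δ / 2 := by
    have : η * (|B| + 1) = δ / 2 := by rw [hη]; field_simp
    nlinarith [le_abs_self B]
  nlinarith [neg_abs_le (l0 φ - D)]

end Duality

/-! ### Derivatives along a convex set. -/

section Directions

variable {H : Type*} [NormedAddCommGroup H] [NormedSpace ℝ H]

/-- Convexity merges `s(x - y) + t(x' - y')` into `s + t` times one difference of convex
combinations; a negative scalar swaps the endpoints. Operator norms on the span can thus be tested
on differences. -/
theorem exists_eq_smul_sub_of_mem_vectorSpan {F : Set H} (hF : Convex ℝ F) (hne : F.Nonempty)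
    {h : H} (hh : h ∈ vectorSpan ℝ F) : ∃ x ∈ F, ∃ y ∈ F, ∃ t : ℝ, 0 ≤ t ∧ h = t • (x - y) := by
  obtain ⟨z, hz⟩ := hne
  rw [vectorSpan] at hh
  induction hh using Submodule.span_induction with
  | mem h hh =>
    obtain ⟨x, hx, y, hy, rfl⟩ := hh
    exact ⟨x, hx, y, hy, 1, zero_le_one, by simp⟩
  | zero => exact ⟨z, hz, z, hz, 0, le_rfl, by simp⟩
  | add h k _ _ ih ik =>
    obtain ⟨x, hx, y, hy, s, hs, rfl⟩ := ih
    obtain ⟨x', hx', y', hy', t, ht, rfl⟩ := ik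
    rcases (add_nonneg hs ht).eq_or_lt with h0 | h0
    · have hs' : s = 0 := by linarith
      have ht' : t = 0 := by linarith
      exact ⟨z, hz, z, hz, 0, le_rfl, by simp [hs', ht']⟩
    · have hst : s / (s + t) + t / (s + t) = 1 := by field_simp
      refine ⟨(s / (s + t)) • x + (t / (s + t)) • x',
        hF hx hx' (by positivity) (by positivity) hst,
        (s / (s + t)) • y + (t / (s + t)) • y',
        hF hy hy' (by positivity) (by positivity) hst, s + t, h0.le, ?_⟩
      simp only [smul_sub, smul_add, smul_smul, mul_div_cancel₀ _ h0.ne']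
      abel
  | smul a h _ ih =>
    obtain ⟨x, hx, y, hy, s, hs, rfl⟩ := ih
    rcases le_total 0 a with ha | ha
    · exact ⟨x, hx, y, hy, a * s, mul_nonneg ha hs, by rw [smul_smul]⟩
    · refine ⟨y, hy, x, hx, -a * s, mul_nonneg (by linarith) hs, ?_⟩
      rw [smul_smul, ← neg_sub x y, smul_neg, neg_mul, neg_smul, neg_neg]

/-- The segment from `φ` to `x` stays in `F`, so `J (x - φ)` is determined by `q` even where `J`
itself is not. -/
theorem tendsto_differenceQuotient {F : Set H} (hF : Convex ℝ F) {q : H → ℝ} {J : H →L[ℝ] ℝ}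
    {φ x : H} (hφ : φ ∈ F) (hx : x ∈ F) (hJ : HasFDerivWithinAt q J F φ) :
    Tendsto (fun n : ℕ => ((n : ℝ) + 1) * (q (φ + (1 / ((n : ℝ) + 1)) • (x - φ)) - q φ)) atTop
      (𝓝 (J (x - φ))) := by
  have ht : Tendsto (fun n : ℕ => 1 / ((n : ℝ) + 1)) atTop (𝓝 0) :=
    tendsto_one_div_add_atTop_nhds_zero_nat
  refine hJ.lim (c := fun n : ℕ => (n : ℝ) + 1) (d := fun n : ℕ => (1 / ((n : ℝ) + 1)) • (x - φ))
    ?_ ?_ ?_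
  · simpa using ht.smul_const (x - φ)
  · refine Eventually.of_forall fun n => hF.add_smul_sub_mem hφ hx ⟨by positivity, ?_⟩
    rw [div_le_one (by positivity)]
    linarith [(Nat.cast_nonneg n : (0 : ℝ) ≤ n)]
  · refine tendsto_const_nhds.congr fun n => ?_
    rw [smul_smul, mul_one_div_cancel (by positivity), one_smul]

theorem one_div_nat_add_one_mem_Icc (n : ℕ) : 1 / ((n : ℝ) + 1) ∈ Set.Icc (0 : ℝ) 1 :=
  ⟨by positivity, by
    rw [div_le_one (by positivity)]; linarith [(Nat.cast_nonneg n : (0 : ℝ) ≤ n)]⟩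

theorem abs_derivWithin_sub_le {F : Set H} (hF : Convex ℝ F) {M : ℝ≥0} {q : H → ℝ}
    (hq : LipschitzOnWith M q F) {J : H →L[ℝ] ℝ} {φ x : H} (hφ : φ ∈ F) (hx : x ∈ F)
    (hJ : HasFDerivWithinAt q J F φ) : |J (x - φ)| ≤ M * ‖x - φ‖ := by
  refine le_of_tendsto (tendsto_differenceQuotient hF hφ hx hJ).abs
    (Eventually.of_forall fun n => ?_)
  have h1 := hq.norm_sub_le (hF.add_smul_sub_mem hφ hx (one_div_nat_add_one_mem_Icc n)) hφ
  have hn : (0 : ℝ) < n + 1 := by positivity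
  rw [add_sub_cancel_left, norm_smul, Real.norm_eq_abs, Real.norm_eq_abs,
    abs_of_nonneg (one_div_nat_add_one_mem_Icc n).1] at h1
  rw [abs_mul, abs_of_pos hn]
  calc ((n : ℝ) + 1) * |q (φ + (1 / ((n : ℝ) + 1)) • (x - φ)) - q φ|
      ≤ ((n : ℝ) + 1) * (M * (1 / ((n : ℝ) + 1) * ‖x - φ‖)) := by gcongr
    _ = M * ‖x - φ‖ := by field_simp

theorem StrongConvexOn.derivWithin_sub_le {F : Set H} {μ₀ : ℝ} {q : H → ℝ}
    (hq : StrongConvexOn F μ₀ q) {J : H →L[ℝ] ℝ} {φ x : H} (hφ : φ ∈ F) (hx : x ∈ F)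
    (hJ : HasFDerivWithinAt q J F φ) :
    J (x - φ) + μ₀ / 2 * ‖x - φ‖ ^ 2 ≤ q x - q φ := by
  have hlim : Tendsto (fun n : ℕ => ((n : ℝ) + 1) * (q (φ + (1 / ((n : ℝ) + 1)) • (x - φ)) - q φ) +
      (1 - 1 / ((n : ℝ) + 1)) * (μ₀ / 2 * ‖x - φ‖ ^ 2)) atTop
      (𝓝 (J (x - φ) + (1 - 0) * (μ₀ / 2 * ‖x - φ‖ ^ 2))) :=
    (tendsto_differenceQuotient hq.1 hφ hx hJ).add
      ((tendsto_const_nhds.sub tendsto_one_div_add_atTop_nhds_zero_nat).mul_const _)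
  rw [sub_zero, one_mul] at hlim
  refine le_of_tendsto hlim (Eventually.of_forall fun n => ?_)
  obtain ⟨hs0, hs1⟩ := one_div_nat_add_one_mem_Icc n
  have hn : (0 : ℝ) < n + 1 := by positivity
  have hsn : ((n : ℝ) + 1) * (1 / ((n : ℝ) + 1)) = 1 := mul_one_div_cancel hn.ne'
  set s := 1 / ((n : ℝ) + 1) with hs
  have h1 := hq.2 hx hφ hs0 (sub_nonneg.2 hs1) (by ring)
  have h2 : s • x + (1 - s) • φ = φ + s • (x - φ) := by module
  rw [h2] at h1
  simp only [smul_eq_mul] at h1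
  have h3 := mul_le_mul_of_nonneg_left h1 hn.le
  have h4 : ((n : ℝ) + 1) * (s * q x + (1 - s) * q φ - s * (1 - s) * (μ₀ / 2 * ‖x - φ‖ ^ 2)) =
      ((n : ℝ) + 1) * q φ +
        (((n : ℝ) + 1) * s) * (q x - q φ - (1 - s) * (μ₀ / 2 * ‖x - φ‖ ^ 2)) := by ring
  rw [h4, hsn] at h3
  linarith

/-- Quadratic growth without derivatives: compare `a` with a point at fraction `s` of the segment to
`x`, divide by `s`, and let `s → 0`. -/
theorem StrongConvexOn.add_norm_sq_le_of_isMinOn {F : Set H} {μ₀ : ℝ} {q : H → ℝ}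
    (hq : StrongConvexOn F μ₀ q) {a x : H} (ha : a ∈ F) (hx : x ∈ F)
    (hmin : ∀ y ∈ F, q a ≤ q y) : q a + μ₀ / 2 * ‖x - a‖ ^ 2 ≤ q x := by
  have hlim : Tendsto (fun n : ℕ => q a + (1 - 1 / ((n : ℝ) + 1)) * (μ₀ / 2 * ‖x - a‖ ^ 2)) atTop
      (𝓝 (q a + (1 - 0) * (μ₀ / 2 * ‖x - a‖ ^ 2))) :=
    ((tendsto_const_nhds.sub tendsto_one_div_add_atTop_nhds_zero_nat).mul_const _).const_add _
  rw [sub_zero, one_mul] at hlim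
  refine le_of_tendsto hlim (Eventually.of_forall fun n => ?_)
  obtain ⟨hs0, hs1⟩ := one_div_nat_add_one_mem_Icc n
  have hs0' : 0 < 1 / ((n : ℝ) + 1) := by positivity
  set s := 1 / ((n : ℝ) + 1) with hs
  have h1 := hq.2 hx ha hs0 (sub_nonneg.2 hs1) (by ring)
  have h2 := hmin _ (hq.1 hx ha hs0 (sub_nonneg.2 hs1) (by ring))
  simp only [smul_eq_mul] at h1
  refine le_of_mul_le_mul_left ?_ hs0'
  linarith

/-- The derivative along a convex set of a Lipschitz function with Lipschitz derivative is bounded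
by the Lipschitz constant, also at points of the boundary. -/
theorem norm_alongF_le {F : Set H} (hF : Convex ℝ F) {M β : ℝ≥0} {q : H → ℝ}
    (hq : LipschitzOnWith M q F) (hsmooth : SmoothAlong F β q) {φ : H} (hφ : φ ∈ F)
    {J : H →L[ℝ] ℝ} (hJ : HasFDerivWithinAt q J F φ) : ‖alongF F J‖ ≤ M := by
  obtain ⟨D, hD, hDLip⟩ := hsmooth
  have hJD : ∀ x ∈ F, J (x - φ) = D φ (x - φ) := fun x hx =>
    tendsto_nhds_unique (tendsto_differenceQuotient hF hφ hx hJ)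
      (tendsto_differenceQuotient hF hφ hx (hD φ hφ))
  -- At a boundary point `φ`, neither `x - y` nor a small multiple need be an admissible increment.
  -- Shrinking `x` and `y` towards `φ` by `s` makes `s(x - y)` admissible at `φ + s(y - φ)`; the
  -- Lipschitz derivative carries the bound back to `φ` with an error of order `s`.
  have hbound : ∀ x ∈ F, ∀ y ∈ F, |D φ (x - y)| ≤ M * ‖x - y‖ := by
    intro x hx y hy
    have hlim : Tendsto (fun n : ℕ =>
        (M + 1 / ((n : ℝ) + 1) * (β * ‖y - φ‖)) * ‖x - y‖) atTop
        (𝓝 ((M + 0 * (β * ‖y - φ‖)) * ‖x - y‖)) :=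
      ((tendsto_one_div_add_atTop_nhds_zero_nat.mul_const _).const_add _).mul_const _
    rw [zero_mul, add_zero] at hlim
    refine ge_of_tendsto hlim (Eventually.of_forall fun n => ?_)
    have hs := one_div_nat_add_one_mem_Icc n
    have hs0 : 0 < 1 / ((n : ℝ) + 1) := by positivity
    set s := 1 / ((n : ℝ) + 1)
    have hc := hF.add_smul_sub_mem hφ hy hs
    have h1 := abs_derivWithin_sub_le hF hq hc (hF.add_smul_sub_mem hφ hx hs) (hD _ hc)
    have h2 : φ + s • (x - φ) - (φ + s • (y - φ)) = s • (x - y) := by module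
    rw [h2, map_smul, smul_eq_mul, abs_mul, norm_smul, Real.norm_eq_abs, abs_of_pos hs0] at h1
    have h3 : |D (φ + s • (y - φ)) (x - y)| ≤ M * ‖x - y‖ :=
      le_of_mul_le_mul_left (by linarith) hs0
    have h4 := hDLip.norm_sub_le hφ hc
    have h5 := (alongF F (D φ) - alongF F (D (φ + s • (y - φ)))).le_opNorm
      ⟨x - y, vsub_mem_vectorSpan ℝ hx hy⟩
    have h6 : (alongF F (D φ) - alongF F (D (φ + s • (y - φ))))
        ⟨x - y, vsub_mem_vectorSpan ℝ hx hy⟩ =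
        D φ (x - y) - D (φ + s • (y - φ)) (x - y) := rfl
    rw [h6, Real.norm_eq_abs, Submodule.coe_norm] at h5
    have h7 : ‖φ - (φ + s • (y - φ))‖ = s * ‖y - φ‖ := by
      rw [sub_add_cancel_left, norm_neg, norm_smul, Real.norm_eq_abs, abs_of_pos hs0]
    rw [h7] at h4
    have h8 := mul_le_mul_of_nonneg_right h4 (norm_nonneg (x - y))
    have h9 := abs_sub_abs_le_abs_sub (D φ (x - y)) (D (φ + s • (y - φ)) (x - y))
    have h10 := h5.trans h8
    linarith
  refine ContinuousLinearMap.opNorm_le_bound _ M.2 ?_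
  rintro ⟨h, hh⟩
  obtain ⟨x, hx, y, hy, t, ht, rfl⟩ := exists_eq_smul_sub_of_mem_vectorSpan hF ⟨φ, hφ⟩ hh
  change ‖J (t • (x - y))‖ ≤ M * ‖t • (x - y)‖
  have h1 : J (x - y) = D φ (x - y) := by
    rw [← sub_sub_sub_cancel_right x y φ, map_sub J, map_sub (D φ), hJD x hx, hJD y hy]
  rw [map_smul, h1, smul_eq_mul, norm_mul, norm_smul, Real.norm_eq_abs, Real.norm_eq_abs]
  calc |t| * |D φ (x - y)| ≤ |t| * (M * ‖x - y‖) := by gcongr; exact hbound x hx y hy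
    _ = M * (|t| * ‖x - y‖) := by ring

/-- On a class with two distinct points the smoothness constant dominates the modulus of strong
convexity. -/
theorem StrongConvexOn.le_of_smoothAlong {F : Set H} {μ₀ : ℝ} {β : ℝ≥0} {q : H → ℝ}
    (hq : StrongConvexOn F μ₀ q) (hsmooth : SmoothAlong F β q) (hF : F.Nontrivial) :
    μ₀ ≤ β := by
  obtain ⟨D, hD, hDLip⟩ := hsmooth
  obtain ⟨x, hx, y, hy, hxy⟩ := hF
  have h1 := StrongConvexOn.derivWithin_sub_le hq hx hy (hD x hx)
  have h2 := StrongConvexOn.derivWithin_sub_le hq hy hx (hD y hy)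
  have hd : 0 < ‖x - y‖ := norm_pos_iff.2 (sub_ne_zero.2 hxy)
  rw [← neg_sub x y, map_neg, norm_neg] at h1
  have h3 := (alongF F (D x) - alongF F (D y)).le_opNorm ⟨x - y, vsub_mem_vectorSpan ℝ hx hy⟩
  have h4 : (alongF F (D x) - alongF F (D y)) ⟨x - y, vsub_mem_vectorSpan ℝ hx hy⟩ =
      D x (x - y) - D y (x - y) := rfl
  rw [h4, Real.norm_eq_abs, Submodule.coe_norm] at h3
  have h5 := mul_le_mul_of_nonneg_right (hDLip.norm_sub_le hx hy) hd.le
  have h6 := le_abs_self (D x (x - y) - D y (x - y))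
  have h7 := h3.trans h5
  -- Adding `h1` and `h2` gives strong monotonicity of the derivative; `h7` bounds the same pairing
  -- from above.
  have h8 : μ₀ * ‖x - y‖ ^ 2 ≤ β * ‖x - y‖ ^ 2 := by
    nlinarith
  exact le_of_mul_le_mul_right h8 (by positivity)

end Directions

/-! ### Regularity of the Lagrangian and comparison of the two classes. -/

section Lagrangian

variable {H : Type*} {m : ℕ}
  {l0 : H → ℝ} {l : Fin m → H → ℝ}

theorem l1Norm_nonneg (v : Fin m → ℝ) : 0 ≤ l1Norm v :=
  Finset.sum_nonneg fun _ _ => abs_nonneg _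

theorem abs_sum_mul_le_l1Norm_mul {v u : Fin m → ℝ} {C : ℝ} (hu : ∀ i, |u i| ≤ C) :
    |∑ i, v i * u i| ≤ l1Norm v * C := by
  rw [l1Norm, Finset.sum_mul]
  refine (Finset.abs_sum_le_sum_abs _ _).trans (Finset.sum_le_sum fun i _ => ?_)
  rw [abs_mul]
  exact mul_le_mul_of_nonneg_left (hu i) (abs_nonneg _)

theorem abs_lagrangian_sub_le [NormedAddCommGroup H] {F : Set H} {M : ℝ≥0}
    (h0 : LipschitzOnWith M l0 F)
    (hl : ∀ i, LipschitzOnWith M (l i) F) (v : Fin m → ℝ) {x y : H} (hx : x ∈ F) (hy : y ∈ F) :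
    |lagrangian l0 l x v - lagrangian l0 l y v| ≤ (1 + l1Norm v) * (M * ‖x - y‖) := by
  have h1 : lagrangian l0 l x v - lagrangian l0 l y v =
      (l0 x - l0 y) + ∑ i, v i * (l i x - l i y) := by
    simp only [lagrangian, mul_sub, Finset.sum_sub_distrib]; ring
  rw [h1, add_mul, one_mul]
  exact (abs_add_le _ _).trans (add_le_add (h0.norm_sub_le hx hy)
    (abs_sum_mul_le_l1Norm_mul fun i => (hl i).norm_sub_le hx hy))

theorem continuousOn_lagrangian [NormedAddCommGroup H] {F : Set H} (h0 : ContinuousOn l0 F)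
    (hl : ∀ i, ContinuousOn (l i) F) (v : Fin m → ℝ) :
    ContinuousOn (fun φ => lagrangian l0 l φ v) F :=
  h0.add (continuousOn_finsetSum _ fun i _ => continuousOn_const.mul (hl i))

theorem strongConvexOn_lagrangian [NormedAddCommGroup H] [NormedSpace ℝ H] {F : Set H} {μ₀ : ℝ}
    (h0 : StrongConvexOn F μ₀ l0)
    (hl : ∀ i, ConvexOn ℝ F (l i)) {v : Fin m → ℝ} (hv : 0 ≤ v) :
    StrongConvexOn F μ₀ (fun φ => lagrangian l0 l φ v) := by
  refine ⟨h0.1, fun x hx y hy a b ha hb hab => ?_⟩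
  have h1 := h0.2 hx hy ha hb hab
  have h2 : ∑ i, v i * l i (a • x + b • y) ≤ ∑ i, v i * (a * l i x + b * l i y) :=
    Finset.sum_le_sum fun i _ =>
      mul_le_mul_of_nonneg_left ((hl i).2 hx hy ha hb hab) (hv i)
  have h3 : ∑ i, v i * (a * l i x + b * l i y) =
      a * ∑ i, v i * l i x + b * ∑ i, v i * l i y := by
    rw [Finset.mul_sum, Finset.mul_sum, ← Finset.sum_add_distrib]
    exact Finset.sum_congr rfl fun i _ => by ring
  simp only [lagrangian, smul_eq_mul] at h1 ⊢
  linarith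

theorem dualFunction_eq_of_mem_lagrangianMinimizers {S : Set H} {v : Fin m → ℝ} {φ : H}
    (hφ : φ ∈ lagrangianMinimizers l0 l S v) : dualFunction l0 l S v = lagrangian l0 l φ v := by
  have : Nonempty S := ⟨⟨φ, hφ.1⟩⟩
  exact le_antisymm (ciInf_le (f := fun ψ : S => lagrangian l0 l ψ v)
    ⟨lagrangian l0 l φ v, by rintro _ ⟨ψ, rfl⟩; exact hφ.2 ψ ψ.2⟩ ⟨φ, hφ.1⟩)
    (le_ciInf fun ψ : S => hφ.2 ψ ψ.2)

theorem lagrangian_le_of_feasible {S : Set H} {v : Fin m → ℝ} (hv : 0 ≤ v) {φ : H}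
    (hφ : φ ∈ feasibleSet l S) : lagrangian l0 l φ v ≤ l0 φ := by
  have : ∑ i, v i * l i φ ≤ 0 :=
    Finset.sum_nonpos fun i _ => mul_nonpos_of_nonneg_of_nonpos (hv i) (hφ.2 i)
  rw [lagrangian]; linarith

theorem exists_mem_lagrangianMinimizers [NormedAddCommGroup H] {F : Set H} (hcomp : IsCompact F)
    (hne : F.Nonempty)
    (h0 : ContinuousOn l0 F) (hl : ∀ i, ContinuousOn (l i) F) (v : Fin m → ℝ) :
    ∃ a, a ∈ lagrangianMinimizers l0 l F v := by
  obtain ⟨a, ha, hmin⟩ := hcomp.exists_isMinOn hne (continuousOn_lagrangian h0 hl v)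
  exact ⟨a, ha, fun ψ hψ => hmin hψ⟩

/-- A bound for the dual function over a subclass, perturbed by `c ‖v‖₁`, is attained by the
objective at a point of the full class that satisfies the constraints tightened by `c`. -/
theorem exists_feasible_of_dualFunction_le [NormedAddCommGroup H] [NormedSpace ℝ H] {F S : Set H}
    (hcomp : IsCompact F) (hS : S ⊆ F)
    (hSne : S.Nonempty) (h0 : ConvexOn ℝ F l0) (hl : ∀ i, ConvexOn ℝ F (l i))
    (hc0 : ContinuousOn l0 F) (hcl : ∀ i, ContinuousOn (l i) F) (c D : ℝ)
    (hD : ∀ w : Fin m → ℝ, 0 ≤ w → dualFunction l0 l S w + c * l1Norm w ≤ D) :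
    ∃ φ ∈ F, (∀ i, l i φ + c ≤ 0) ∧ l0 φ ≤ D := by
  have hne := hSne.mono hS
  have : Nonempty S := hSne.to_subtype
  refine exists_feasible_of_dual_le hcomp hne h0 hl hc0 hcl c D fun w hw => ?_
  obtain ⟨a, ha, hmin⟩ := exists_mem_lagrangianMinimizers hcomp hne hc0 hcl w
  refine ⟨a, ha, le_trans ?_ (hD w hw)⟩
  have : lagrangian l0 l a w ≤ dualFunction l0 l S w :=
    le_ciInf fun ψ : S => hmin ψ (hS ψ.2)
  linarith

/-- The minimum of the Lagrangian over a `ν`-dense subclass exceeds its values on the full class by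
at most `M ν (1 + ‖v‖₁)`. -/
theorem lagrangian_le_add_of_dense [NormedAddCommGroup H] {F S : Set H} {M : ℝ≥0} {ν : ℝ}
    (hS : S ⊆ F) (hLip0 : LipschitzOnWith M l0 F) (hLip : ∀ i, LipschitzOnWith M (l i) F)
    (hdense : ∀ φ ∈ F, ∃ ψ ∈ S, ‖φ - ψ‖ ≤ ν) {v : Fin m → ℝ} {fP φ : H}
    (hfP : fP ∈ lagrangianMinimizers l0 l S v) (hφ : φ ∈ F) :
    lagrangian l0 l fP v ≤ lagrangian l0 l φ v + M * ν * (1 + l1Norm v) := by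
  obtain ⟨ψ, hψ, hψν⟩ := hdense φ hφ
  have h1 := abs_lagrangian_sub_le hLip0 hLip v hφ (hS hψ)
  have h2 : (1 + l1Norm v) * (M * ‖φ - ψ‖) ≤ (1 + l1Norm v) * (M * ν) := by
    have := l1Norm_nonneg v
    gcongr
  have h3 := neg_abs_le (lagrangian l0 l φ v - lagrangian l0 l ψ v)
  have h4 := hfP.2 ψ hψ
  linarith

end Lagrangian

/-! ### Comparison with `Gamma2`. -/

section Constants

variable {m : ℕ} {M ν μ₀ β σ : ℝ}

theorem Gamma2_nonneg (hM : 0 ≤ M) (hβ : 0 ≤ β) (hμ₀ : 0 < μ₀) (hσ : 0 < σ)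
    (vu vp : Fin m → ℝ) : 0 ≤ Gamma2 M ν μ₀ β σ vu vp := by
  have := (l1Norm_nonneg vu).trans (le_max_left _ (l1Norm vp))
  rw [Gamma2]
  positivity

/-- Since `κ₁, κ₀ ≥ 1`, the bracket in `Gamma2` is at least `2`, which pays for the two legs of the
triangle inequality through the minimizer over `F`. -/
theorem two_mul_sqrt_le_Gamma2 (hM : 0 ≤ M) (hν : 0 ≤ ν) (hμ₀ : 0 < μ₀) (hσ : 0 < σ)
    (hm : 1 ≤ m) (hσM : σ ≤ M) (hμβ : μ₀ ≤ β) (vu vp : Fin m → ℝ) :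
    M * (2 * √(2 * (M * ν / μ₀) * (1 + l1Norm vp))) ≤ Gamma2 M ν μ₀ β σ vu vp := by
  have hΔ := (l1Norm_nonneg vu).trans (le_max_left _ (l1Norm vp))
  have hp := l1Norm_nonneg vp
  have h1 : 1 ≤ M / σ := (one_le_div hσ).2 hσM
  have h2 : 1 ≤ β / μ₀ := (one_le_div hμ₀).2 hμβ
  have h3 : 1 ≤ M / σ * (β / μ₀) * (1 + max (l1Norm vu) (l1Norm vp)) :=
    one_le_mul_of_one_le_of_one_le (one_le_mul_of_one_le_of_one_le h1 h2) (by linarith)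
  have hm' : (1 : ℝ) ≤ m := by exact_mod_cast hm
  have h4 : √(2 * (M * ν / μ₀) * (1 + l1Norm vp)) ≤
      √(2 * m * (M * ν / μ₀) * (1 + l1Norm vp)) := by
    refine Real.sqrt_le_sqrt ?_
    gcongr
    linarith
  rw [Gamma2, mul_assoc M (1 + _)]
  refine mul_le_mul_of_nonneg_left ?_ hM
  exact mul_le_mul (by linarith) h4 (Real.sqrt_nonneg _) (by linarith)

end Constants

/-! ### Distance to the minimizer; what the rank condition forces. -/

section Distance

variable {H : Type*} [NormedAddCommGroup H] [NormedSpace ℝ H] {m : ℕ}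
  {l0 : H → ℝ} {l : Fin m → H → ℝ}

theorem norm_sub_le_sqrt_of_strongConvexOn {F : Set H} {μ₀ ε : ℝ} (hμ₀ : 0 < μ₀) {q : H → ℝ}
    (hq : StrongConvexOn F μ₀ q) {a x : H} (ha : a ∈ F) (hx : x ∈ F)
    (hmin : ∀ y ∈ F, q a ≤ q y) (hε : q x ≤ q a + ε) : ‖x - a‖ ≤ √(2 * (ε / μ₀)) := by
  have h1 := StrongConvexOn.add_norm_sq_le_of_isMinOn hq ha hx hmin
  refine Real.le_sqrt_of_sq_le ?_
  rw [← mul_div_assoc, le_div_iff₀ hμ₀]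
  linarith

/-- The rank constant of the Jacobian and the modulus of strong convexity are dominated by the
Lipschitz and the smoothness constant as soon as there is a constraint. -/
theorem FullRowRank.le_and_le {F : Set H} (hF : Convex ℝ F) {M β : ℝ≥0} {μ₀ σ : ℝ} (hσ : 0 < σ)
    (hstrong : StrongConvexOn F μ₀ l0) (hLip : ∀ i, LipschitzOnWith M (l i) F)
    (hsmooth0 : SmoothAlong F β l0) (hsmooth : ∀ i, SmoothAlong F β (l i)) {φ : H} (hφ : φ ∈ F)
    (hrank : FullRowRank F σ l φ) (i : Fin m) : σ ≤ M ∧ μ₀ ≤ β := by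
  obtain ⟨J, hJ, hJσ⟩ := hrank
  have h1 := hJσ (Pi.single i 1) (by simp [Pi.single_apply])
  have h2 : ∑ j, (Pi.single i (1 : ℝ) : Fin m → ℝ) j • J j = J i := by
    simp [Pi.single_apply]
  rw [h2] at h1
  refine ⟨h1.trans (norm_alongF_le hF (hLip i) (hsmooth i) hφ (hJ i)),
    StrongConvexOn.le_of_smoothAlong hstrong hsmooth0 ?_⟩
  -- If `F` were a single point, its directions would be trivial and the norm in `h1` would vanish,
  -- against `σ > 0`.
  by_contra hnt
  rw [Set.not_nontrivial_iff] at hnt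
  have h3 : ‖alongF F (J i)‖ ≤ 0 := by
    refine ContinuousLinearMap.opNorm_le_bound _ le_rfl ?_
    rintro ⟨h, hh⟩
    rw [vectorSpan_of_subsingleton ℝ hnt, Submodule.mem_bot] at hh
    change ‖J i h‖ ≤ _
    simp [hh]
  linarith

end Distance

/-! ### The two estimates for a `ν`-dense subclass. -/

section NearOptimality

variable {H : Type*} [NormedAddCommGroup H] [NormedSpace ℝ H] {m : ℕ}
  {l0 : H → ℝ} {l : Fin m → H → ℝ}

/-- The optimal value over the full class is at most the optimal dual value over a subclass. -/
theorem le_dualFunction_of_mem_solutions {F S : Set H} (hcomp : IsCompact F) (hS : S ⊆ F)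
    (hSne : S.Nonempty) (h0 : ConvexOn ℝ F l0) (hl : ∀ i, ConvexOn ℝ F (l i))
    (hc0 : ContinuousOn l0 F) (hcl : ∀ i, ContinuousOn (l i) F) {φs : H}
    (hφs : φs ∈ solutions l0 l F) {v : Fin m → ℝ} (hv : v ∈ dualOptimal l0 l S) :
    l0 φs ≤ dualFunction l0 l S v := by
  obtain ⟨φ, hφ, hφl, hφ0⟩ := exists_feasible_of_dualFunction_le hcomp hS hSne h0 hl hc0 hcl 0
    (dualFunction l0 l S v) (fun w hw => by simpa using hv.2 w hw)
  exact (hφs.2 φ ⟨hφ, fun i => by simpa using hφl i⟩).trans hφ0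

/-- Near-feasibility of the Lagrangian minimizers over a `ν`-dense subclass. -/
theorem norm_constraints_sub_le_Gamma2 {F S : Set H} (hF : Convex ℝ F) (hcomp : IsCompact F)
    (hS : S ⊆ F) {M β : ℝ≥0} {μ₀ ν σ : ℝ} (hμ₀ : 0 < μ₀) (hσ : 0 < σ) (hν : 0 ≤ ν)
    (hconv : ∀ i, ConvexOn ℝ F (l i)) (hstrong : StrongConvexOn F μ₀ l0)
    (hLip0 : LipschitzOnWith M l0 F) (hLip : ∀ i, LipschitzOnWith M (l i) F)
    (hdense : ∀ φ ∈ F, ∃ ψ ∈ S, ‖φ - ψ‖ ≤ ν)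
    (hsmooth0 : SmoothAlong F β l0) (hsmooth : ∀ i, SmoothAlong F β (l i))
    {φs : H} (hφs : φs ∈ solutions l0 l F) (hrank : FullRowRank F σ l φs)
    (vu : Fin m → ℝ) {v : Fin m → ℝ} (hv0 : 0 ≤ v)
    {fP : H} (hfP : fP ∈ lagrangianMinimizers l0 l S v)
    (hdual : l0 φs ≤ lagrangian l0 l fP v) (i : Fin m) :
    |l i fP - l i φs| ≤ Gamma2 M ν μ₀ β σ vu v := by
  have hφsF : φs ∈ F := hφs.1.1
  obtain ⟨a, ha, hmin⟩ := exists_mem_lagrangianMinimizers hcomp ⟨φs, hφsF⟩ hLip0.continuousOn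
    (fun i => (hLip i).continuousOn) v
  have hsc := strongConvexOn_lagrangian hstrong hconv hv0
  have hgap := lagrangian_le_add_of_dense hS hLip0 hLip hdense hfP ha
  have hd1 := norm_sub_le_sqrt_of_strongConvexOn hμ₀ hsc ha (hS hfP.1) hmin hgap
  have hd2 := norm_sub_le_sqrt_of_strongConvexOn hμ₀ hsc ha hφsF hmin
    (((lagrangian_le_of_feasible hv0 hφs.1).trans hdual).trans hgap)
  obtain ⟨hσM, hμβ⟩ :=
    FullRowRank.le_and_le hF hσ hstrong hLip hsmooth0 hsmooth hφsF hrank i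
  have hε : 2 * (M * ν * (1 + l1Norm v) / μ₀) = 2 * (M * ν / μ₀) * (1 + l1Norm v) := by ring
  rw [hε] at hd1 hd2
  have hdist : ‖fP - φs‖ ≤ 2 * √(2 * (M * ν / μ₀) * (1 + l1Norm v)) := by
    have := norm_sub_le_norm_sub_add_norm_sub fP a φs
    rw [norm_sub_rev a φs] at this
    linarith
  exact (((hLip i).norm_sub_le (hS hfP.1) hφsF).trans
    (mul_le_mul_of_nonneg_left hdist M.2)).trans
    (two_mul_sqrt_le_Gamma2 M.2 hν hμ₀ hσ (Fin.pos i) hσM hμβ vu v)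

/-- A maximizer of the dual function perturbed by `M ν ‖·‖₁` certifies a feasible point of a
`ν`-dense subclass with objective at most the perturbed dual value plus `M ν`. -/
theorem exists_feasible_le_of_perturbedDualOptimal {F S : Set H} (hcomp : IsCompact F)
    (hS : S ⊆ F) (hSne : S.Nonempty) {M : ℝ≥0} {ν : ℝ}
    (h0 : ConvexOn ℝ F l0) (hl : ∀ i, ConvexOn ℝ F (l i))
    (hLip0 : LipschitzOnWith M l0 F) (hLip : ∀ i, LipschitzOnWith M (l i) F)
    (hdense : ∀ φ ∈ F, ∃ ψ ∈ S, ‖φ - ψ‖ ≤ ν) {w : Fin m → ℝ}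
    (hw : w ∈ perturbedDualOptimal l0 l S (M * ν)) :
    ∃ ψ ∈ feasibleSet l S, l0 ψ ≤ dualFunction l0 l S w + Gamma1 M ν w := by
  obtain ⟨φ, hφ, hφl, hφ0⟩ := exists_feasible_of_dualFunction_le hcomp hS hSne h0 hl
    hLip0.continuousOn (fun i => (hLip i).continuousOn) (M * ν) _ hw.2
  obtain ⟨ψ, hψ, hψν⟩ := hdense φ hφ
  -- Moving from `φ` to `ψ` changes each functional by at most `M ν`, exactly the slack in the
  -- tightened constraints.
  have hMν : M * ‖ψ - φ‖ ≤ M * ν := by rw [norm_sub_rev]; gcongr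
  refine ⟨ψ, ⟨hψ, fun i => ?_⟩, ?_⟩
  · have h1 := (le_abs_self _).trans ((hLip i).norm_sub_le (hS hψ) hφ)
    linarith [hφl i]
  · have h1 := (le_abs_self _).trans (hLip0.norm_sub_le (hS hψ) hφ)
    rw [Gamma1]
    linarith

/-- Near-optimality of the Lagrangian minimizers, given a bound `C` for the distance of their
constraint values to those of the solution over the full class. -/
theorem abs_primalValue_sub_le {F S : Set H} (hcomp : IsCompact F) (hS : S ⊆ F) {M : ℝ≥0}
    {ν C : ℝ} (hν : 0 ≤ ν)
    (h0 : ConvexOn ℝ F l0) (hl : ∀ i, ConvexOn ℝ F (l i))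
    (hLip0 : LipschitzOnWith M l0 F) (hLip : ∀ i, LipschitzOnWith M (l i) F)
    (hdense : ∀ φ ∈ F, ∃ ψ ∈ S, ‖φ - ψ‖ ≤ ν) {φs : H} (hφs : φs ∈ solutions l0 l F)
    {v : Fin m → ℝ} (hv : v ∈ dualOptimal l0 l S)
    {fP : H} (hfP : fP ∈ lagrangianMinimizers l0 l S v)
    (hdual : l0 φs ≤ lagrangian l0 l fP v) (hC : ∀ i, |l i fP - l i φs| ≤ C)
    {w : Fin m → ℝ} (hw : w ∈ perturbedDualOptimal l0 l S (M * ν)) :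
    (feasibleSet l S).Nonempty ∧
      |primalValue l0 l S - l0 fP| ≤
        (1 + l1Norm v) * M * ν + Gamma1 M ν w + l1Norm v * C := by
  obtain ⟨ψ, hψ, hψle⟩ :=
    exists_feasible_le_of_perturbedDualOptimal hcomp hS ⟨fP, hfP.1⟩ h0 hl hLip0 hLip hdense hw
  refine ⟨⟨ψ, hψ⟩, ?_⟩
  have hbound : ∀ x ∈ l0 '' feasibleSet l S, lagrangian l0 l fP v ≤ x := by
    rintro _ ⟨x, hx, rfl⟩
    exact (hfP.2 x hx.1).trans (lagrangian_le_of_feasible hv.1 hx)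
  have hlow : lagrangian l0 l fP v ≤ primalValue l0 l S := le_csInf ⟨_, ψ, hψ, rfl⟩ hbound
  have hup : primalValue l0 l S ≤ lagrangian l0 l fP v + Gamma1 M ν w := by
    have h1 : primalValue l0 l S ≤ l0 ψ := csInf_le ⟨_, hbound⟩ ⟨ψ, hψ, rfl⟩
    have h2 := hv.2 w hw.1
    rw [dualFunction_eq_of_mem_lagrangianMinimizers hfP] at h2
    linarith
  -- With `hdual` this is approximate complementary slackness, `vᵀℓ(φs) ≥ -M ν (1 + ‖v‖₁)`.
  have hgap := lagrangian_le_add_of_dense hS hLip0 hLip hdense hfP hφs.1.1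
  have hφs0 := lagrangian_le_of_feasible (l0 := l0) hv.1 hφs.1
  have hdiff := abs_le.1 (abs_sum_mul_le_l1Norm_mul (v := v) hC)
  simp only [mul_sub, Finset.sum_sub_distrib] at hdiff
  have hΓ1 : 0 ≤ Gamma1 M ν w := by
    have := l1Norm_nonneg w
    rw [Gamma1]; positivity
  have hε : 0 ≤ M * ν * (1 + l1Norm v) := by
    have := l1Norm_nonneg v
    positivity
  simp only [lagrangian] at hlow hup hgap hφs0 hdual
  rw [abs_le]
  constructor <;> linarith [hdiff.1, hdiff.2]

end NearOptimality

end ConstrainedLearning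

theorem theorem3p1
    {X : Type*} [MeasurableSpace X] (μ : Measure X)
    {E : Type*} [NormedAddCommGroup E] [InnerProductSpace ℝ E]
    -- the function class `F`, a compact convex subset of an `L²` space
    (F : Set (Lp E 2 μ)) (hFconv : Convex ℝ F) (hFcomp : IsCompact F)
    -- the parametrized class `{f_θ : θ ∈ Θ} ⊆ F`
    (p : ℕ) (Θ : Set (EuclideanSpace ℝ (Fin p)))
    (f : EuclideanSpace ℝ (Fin p) → Lp E 2 μ) (hf : ∀ θ ∈ Θ, f θ ∈ F)
    -- the objective and the constraint functionals
    (m : ℕ) (l0 : Lp E 2 μ → ℝ) (l : Fin m → Lp E 2 μ → ℝ)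
    (M β : ℝ≥0) (μ₀ ν σ : ℝ) (hμ₀ : 0 < μ₀) (hσ : 0 < σ)
    -- convexity, Lipschitz continuity, strong convexity of the objective
    (hconv : ∀ i, ConvexOn ℝ F (l i)) (hstrong : StrongConvexOn F μ₀ l0)
    (hLip0 : LipschitzOnWith M l0 F) (hLip : ∀ i, LipschitzOnWith M (l i) F)
    -- strengthened Slater condition
    (hslater : ConstrainedLearning.StrongSlater l0 l F (f '' Θ))
    -- near-universality of the parametrization
    (hν : ∀ φ ∈ F, ∃ θ ∈ Θ, ‖φ - f θ‖ ≤ ν)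
    -- smoothness
    (hsmooth0 : ConstrainedLearning.SmoothAlong F β l0)
    (hsmooth : ∀ i, ConstrainedLearning.SmoothAlong F β (l i))
    -- a solution of the unparametrized problem, at which the Jacobian has full row rank
    (φs : Lp E 2 μ) (hφs : φs ∈ ConstrainedLearning.solutions l0 l F)
    (hrank : ConstrainedLearning.FullRowRank F σ l φs)
    -- optimal dual variables of the unparametrized and of the parametrized problem
    (lamU lamP : Fin m → ℝ)
    (hlamU : lamU ∈ ConstrainedLearning.dualOptimal l0 l F)
    (hlamP : lamP ∈ ConstrainedLearning.dualOptimal l0 l (f '' Θ))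
    -- any Lagrangian minimizer `f_θ(λ*_p)`
    (fP : Lp E 2 μ)
    (hfP : fP ∈ ConstrainedLearning.lagrangianMinimizers l0 l (f '' Θ) lamP) :
    -- near-feasibility, in the sup norm of `Fin m → ℝ`
    ‖(fun i => l i fP) - (fun i => l i φs)‖ ≤
        ConstrainedLearning.Gamma2 M ν μ₀ β σ lamU lamP ∧
    -- near-optimality
    ∀ lamT ∈ ConstrainedLearning.perturbedDualOptimal l0 l (f '' Θ) (M * ν),
      (ConstrainedLearning.feasibleSet l (f '' Θ)).Nonempty ∧
      |ConstrainedLearning.primalValue l0 l (f '' Θ) - l0 fP| ≤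
        (1 + ConstrainedLearning.l1Norm lamP) * M * ν + ConstrainedLearning.Gamma1 M ν lamT +
          ConstrainedLearning.l1Norm lamP *
            ConstrainedLearning.Gamma2 M ν μ₀ β σ lamU lamP := by
  have hS : f '' Θ ⊆ F := Set.image_subset_iff.2 hf
  have hdense : ∀ φ ∈ F, ∃ ψ ∈ f '' Θ, ‖φ - ψ‖ ≤ ν := fun φ hφ =>
    let ⟨θ, hθ, h⟩ := hν φ hφ
    ⟨f θ, ⟨θ, hθ, rfl⟩, h⟩
  have hν0 : 0 ≤ ν :=
    let ⟨_, _, h⟩ := hν φs hφs.1.1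
    (norm_nonneg _).trans h
  have h0 : ConvexOn ℝ F l0 := hstrong.convexOn fun r => by positivity
  have hdual : l0 φs ≤ ConstrainedLearning.lagrangian l0 l fP lamP := by
    rw [← ConstrainedLearning.dualFunction_eq_of_mem_lagrangianMinimizers hfP]
    exact ConstrainedLearning.le_dualFunction_of_mem_solutions hFcomp hS ⟨fP, hfP.1⟩ h0 hconv
      hLip0.continuousOn (fun i => (hLip i).continuousOn) hφs hlamP
  have hfeas := ConstrainedLearning.norm_constraints_sub_le_Gamma2 hFconv hFcomp hS hμ₀ hσ hν0
    hconv hstrong hLip0 hLip hdense hsmooth0 hsmooth hφs hrank lamU hlamP.1 hfP hdual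
  refine ⟨?_, fun lamT hlamT => ConstrainedLearning.abs_primalValue_sub_le hFcomp hS hν0 h0 hconv
    hLip0 hLip hdense hφs hlamP hfP hdual hfeas hlamT⟩
  -- Nonnegativity of `Gamma2` also settles `m = 0`, where `hfeas` is vacuous.
  exact (pi_norm_le_iff_of_nonneg
    (ConstrainedLearning.Gamma2_nonneg M.2 β.2 hμ₀ hσ lamU lamP)).2 hfeas
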